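/- **Definitions.** Let $(M,g)$ be a Riemannian $3$-manifold. For $p\in M$ put $\delta_M(p)=\tau(p)-\inf K(p)$, where $\tau(p)=\sum_{i<j}K(e_i\wedge e_j)$ for an orthonormal basis $e_1,e_2,e_3$ of $T_pM$, and $\inf K(p)$ is the infimum of the sectional curvatures of the planes in $T_pM$. Every isometric immersion of $M$ into $\mathbb E^4$ with mean curvature vector $\vec H=\frac13\operatorname{trace}h$ satisfies $\delta_M\le\frac94\|\vec H\|^2$; it is called *ideal* if $\delta_M=\frac94\|\vec H\|^2$ at every point, and *minimal* if $\vec H\equiv0$. Two immersions $f_1,f_2:M\to\mathbb E^4$ are *congruent* if $f_2=F\circ f_1$ for some isometry $F$ of $\mathbb E^4$. An isometric immersion $f:M\to\mathbb E^4$ is *rigid* if every isometric immersion of $M$ into $\mathbb E^4$ is congruent to $f$. Manifolds are connected, and metrics and immersions are $C^\infty$. **Proposition 5.2.** There exist minimal ideal hypersurfaces in $\mathbb E^4$ with three distinct principal curvatures (at every point) which are not rigid. Explicitly, let $$\Omega=\{(s,t,x)\in\mathbb R^3:\ -\sinh^{-1}(1)<s<\sinh^{-1}(1),\ 0<t<2\pi\},\qquad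 g=\cosh^2 s\,(ds^2+dt^2)+dx^2,$$ and let $$L_1(s,t,x)=(\cosh s\cos t,\ \cosh s\sin t,\ s,\ x),\qquad L_2(s,t,x)=(\sinh s\cos t,\ \sinh s\sin t,\ t,\ x).$$ Here $L_1$ parametrizes catenoid$\,\times\mathbb R$, and $L_2$ is the parametrization $(u,v,x)\mapsto(u\cos v,u\sin v,v,x)$, $-1<u<1$, $0<v<2\pi$, of helicoid$\,\times\mathbb R$ composed with the bijective change of parameters $(u,v,x)=(\sinh s,t,x)$. Then $L_1$ and $L_2$ are injective isometric immersions of the same Riemannian $3$-manifold $(\Omega,g)$ into $\mathbb E^4$; both are minimal and ideal and have three distinct principal curvatures at every point; they are not congruent, and neither of them is rigid. -/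

import Mathlib

open scoped ContDiff RealInnerProductSpace

noncomputable section

namespace IdealHypersurface

/-- Euclidean `n`-space. -/
abbrev Euc (n : ℕ) : Type := EuclideanSpace ℝ (Fin n)

/-- The `i`-th coordinate vector. -/
def coordVec {n : ℕ} (i : Fin n) : Euc n := EuclideanSpace.single i 1

/-- The `i`-th partial derivative of `F` at `p`. -/
def pderiv {n : ℕ} {V : Type*} [NormedAddCommGroup V] [NormedSpace ℝ V]
    (i : Fin n) (F : Euc n → V) (p : Euc n) : V :=
  fderiv ℝ F p (coordVec i)

/-! ### Riemannian manifolds covered by one chart -/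

/-- `(Ω, g)` is a connected Riemannian manifold covered by a single chart: `Ω` is a nonempty
connected open subset of `ℝⁿ`, and `g p` is the matrix `(g_{ij}(p))` of a smooth Riemannian
metric on it. -/
structure IsRiemannianDomain {n : ℕ} (Ω : Set (Euc n))
    (g : Euc n → Matrix (Fin n) (Fin n) ℝ) : Prop where
  isOpen : IsOpen Ω
  isConnected : IsConnected Ω
  smooth : ∀ i j, ContDiffOn ℝ ∞ (fun p => g p i j) Ω
  posDef : ∀ p ∈ Ω, (g p).PosDef

/-- The inner product `g_p(X, Y)` of two tangent vectors at `p`. -/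
def metricInner {n : ℕ} (g : Euc n → Matrix (Fin n) (Fin n) ℝ) (p X Y : Euc n) : ℝ :=
  ∑ i, ∑ j, g p i j * X i * Y j

/-- The Christoffel symbols `Γ^k_{ij}` of the Levi-Civita connection:
`∇_{∂_i} ∂_j = ∑_k Γ^k_{ij} ∂_k`. -/
def christoffel {n : ℕ} (g : Euc n → Matrix (Fin n) (Fin n) ℝ) (k i j : Fin n)
    (p : Euc n) : ℝ :=
  (1 / 2) * ∑ l, (g p)⁻¹ k l *
    (pderiv i (fun q => g q j l) p + pderiv j (fun q => g q i l) p
      - pderiv l (fun q => g q i j) p)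

/-- The components of the Riemann curvature tensor
`R(X, Y) Z = ∇_X ∇_Y Z - ∇_Y ∇_X Z - ∇_{[X, Y]} Z`:
`R(∂_i, ∂_j) ∂_k = ∑_l (curvatureCoeff g l k i j) ∂_l`. -/
def curvatureCoeff {n : ℕ} (g : Euc n → Matrix (Fin n) (Fin n) ℝ) (l k i j : Fin n)
    (p : Euc n) : ℝ :=
  pderiv i (christoffel g l j k) p - pderiv j (christoffel g l i k) p
    + ∑ m, (christoffel g m j k p * christoffel g l i m p
      - christoffel g m i k p * christoffel g l j m p)

/-- The value `R(X, Y; Z, W) = g(R(X, Y) Z, W)` of the Riemann curvature tensor at `p`. -/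
def riemann {n : ℕ} (g : Euc n → Matrix (Fin n) (Fin n) ℝ) (p X Y Z W : Euc n) : ℝ :=
  ∑ i, ∑ j, ∑ k, ∑ l, ∑ m,
    g p l m * curvatureCoeff g l k i j p * X i * Y j * Z k * W m

/-- The sectional curvature of the plane spanned by the linearly independent tangent vectors
`X`, `Y` at `p`. -/
def sectionalCurvature {n : ℕ} (g : Euc n → Matrix (Fin n) (Fin n) ℝ) (p X Y : Euc n) : ℝ :=
  riemann g p X Y Y X /
    (metricInner g p X X * metricInner g p Y Y - metricInner g p X Y ^ 2)

/-- The set of all sectional curvatures at `p`. -/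
def sectionalCurvatures {n : ℕ} (g : Euc n → Matrix (Fin n) (Fin n) ℝ) (p : Euc n) : Set ℝ :=
  {K | ∃ X Y : Euc n, LinearIndependent ℝ ![X, Y] ∧ K = sectionalCurvature g p X Y}

/-- `e` is an orthonormal basis of the tangent space at `p`. -/
def IsOrthonormalFrame {n : ℕ} (g : Euc n → Matrix (Fin n) (Fin n) ℝ) (p : Euc n)
    (e : Fin n → Euc n) : Prop :=
  ∀ a b, metricInner g p (e a) (e b) = if a = b then 1 else 0

/-- `τ` is the scalar curvature at `p`: the sum `∑_{a < b} K(e_a ∧ e_b)` equals `τ` for every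
orthonormal basis `e` of the tangent space at `p` (and there is such a basis). -/
def HasScalarCurvatureAt {n : ℕ} (g : Euc n → Matrix (Fin n) (Fin n) ℝ) (p : Euc n)
    (τ : ℝ) : Prop :=
  (∃ e, IsOrthonormalFrame g p e) ∧
    ∀ e, IsOrthonormalFrame g p e →
      ∑ a, ∑ b ∈ Finset.univ.filter (fun b => a < b), sectionalCurvature g p (e a) (e b) = τ

/-- `d` is the value at `p` of the invariant `δ_M = τ - inf K`. -/
def HasDeltaAt {n : ℕ} (g : Euc n → Matrix (Fin n) (Fin n) ℝ) (p : Euc n) (d : ℝ) : Prop :=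
  ∃ τ k : ℝ, HasScalarCurvatureAt g p τ ∧ IsGLB (sectionalCurvatures g p) k ∧ d = τ - k

/-! ### Hypersurfaces -/

/-- `f` is a smooth isometric immersion of `(Ω, g)` into Euclidean `m`-space. (When `g` is
positive definite on `Ω`, the differential of `f` is automatically injective there.) -/
structure IsIsometricImmersion {n m : ℕ} (Ω : Set (Euc n))
    (g : Euc n → Matrix (Fin n) (Fin n) ℝ) (f : Euc n → Euc m) : Prop where
  smooth : ContDiffOn ℝ ∞ f Ω
  isometric : ∀ p ∈ Ω, ∀ X Y : Euc n,
    ⟪fderiv ℝ f p X, fderiv ℝ f p Y⟫ = metricInner g p X Y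

/-- The normal space of `f` at `p`. -/
def normalSpace {n m : ℕ} (f : Euc n → Euc m) (p : Euc n) : Submodule ℝ (Euc m) :=
  (LinearMap.range (fderiv ℝ f p).toLinearMap)ᗮ

/-- The second fundamental form `h(X, Y)`: the normal component of the second derivative of `f`
at `p` in the directions `X`, `Y`. -/
def secondFundamentalForm {n m : ℕ} (f : Euc n → Euc m) (p X Y : Euc n) : Euc m :=
  (normalSpace f p).starProjection (fderiv ℝ (fun q => fderiv ℝ f q Y) p X)

/-- The mean curvature vector `(1/n) trace h`, the trace being taken with respect to `g`. -/
def meanCurvatureVector {n m : ℕ} (g : Euc n → Matrix (Fin n) (Fin n) ℝ)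
    (f : Euc n → Euc m) (p : Euc n) : Euc m :=
  (1 / (n : ℝ)) • ∑ i, ∑ j,
    (g p)⁻¹ i j • secondFundamentalForm f p (coordVec i) (coordVec j)

/-- The immersion is minimal: its mean curvature vector vanishes identically. -/
def IsMinimal {n m : ℕ} (Ω : Set (Euc n)) (g : Euc n → Matrix (Fin n) (Fin n) ℝ)
    (f : Euc n → Euc m) : Prop :=
  ∀ p ∈ Ω, meanCurvatureVector g f p = 0

/-- An isometric immersion of a Riemannian 3-manifold into Euclidean 4-space is ideal if it
satisfies the equality case `δ_M = (9/4) H²` of Chen's inequality `δ_M ≤ (9/4) H²` at every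
point, where `H² = ⟨H, H⟩` for the mean curvature vector `H`. -/
def IsIdeal (Ω : Set (Euc 3)) (g : Euc 3 → Matrix (Fin 3) (Fin 3) ℝ)
    (f : Euc 3 → Euc 4) : Prop :=
  ∀ p ∈ Ω, HasDeltaAt g p (9 / 4 * ‖meanCurvatureVector g f p‖ ^ 2)

/-- `A` is the shape operator `A_ξ` at `p`: `⟨A_ξ X, Y⟩ = ⟨h(X, Y), ξ⟩`. -/
def IsShapeOperator {n m : ℕ} (g : Euc n → Matrix (Fin n) (Fin n) ℝ) (f : Euc n → Euc m)
    (p : Euc n) (ξ : Euc m) (A : Module.End ℝ (Euc n)) : Prop :=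
  ∀ X Y : Euc n, metricInner g p (A X) Y = ⟪secondFundamentalForm f p X Y, ξ⟫

/-- The hypersurface `f` has exactly `k` distinct principal curvatures at each point: the shape
operator of a unit normal vector `ξ` has exactly `k` distinct eigenvalues. (The unit normal is
unique up to sign, so that the number `k` does not depend on its choice.) -/
def HasDistinctPrincipalCurvatures {n : ℕ} (Ω : Set (Euc n))
    (g : Euc n → Matrix (Fin n) (Fin n) ℝ) (f : Euc n → Euc (n + 1)) (k : ℕ) : Prop :=
  ∀ p ∈ Ω, ∃ ξ ∈ normalSpace f p, ‖ξ‖ = 1 ∧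
    ∃ A : Module.End ℝ (Euc n), IsShapeOperator g f p ξ A ∧
      {κ : ℝ | A.HasEigenvalue κ}.ncard = k

/-- Two immersions of `Ω` are congruent if they differ by an isometry of the ambient space. -/
def AreCongruent {n m : ℕ} (Ω : Set (Euc n)) (f₁ f₂ : Euc n → Euc m) : Prop :=
  ∃ F : Euc m ≃ᵢ Euc m, ∀ p ∈ Ω, f₂ p = F (f₁ p)

/-- The isometric immersion `f` of `(Ω, g)` is rigid: it is the only isometric immersion of
`(Ω, g)` into Euclidean `m`-space, up to isometries of Euclidean `m`-space. -/
def IsRigid {n m : ℕ} (Ω : Set (Euc n)) (g : Euc n → Matrix (Fin n) (Fin n) ℝ)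
    (f : Euc n → Euc m) : Prop :=
  ∀ f' : Euc n → Euc m, IsIsometricImmersion Ω g f' → AreCongruent Ω f f'

/-! ### The catenoid and the helicoid -/

/-- The parameter domain of catenoid × ℝ: `-sinh⁻¹ 1 < s < sinh⁻¹ 1`, `0 < t < 2π`, `x ∈ ℝ`. -/
def catenoidDomain : Set (Euc 3) :=
  {p | -Real.arsinh 1 < p 0 ∧ p 0 < Real.arsinh 1 ∧ 0 < p 1 ∧ p 1 < 2 * Real.pi}

/-- The parameter domain of helicoid × ℝ: `-1 < u < 1`, `0 < v < 2π`, `x ∈ ℝ`. -/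
def helicoidDomain : Set (Euc 3) :=
  {p | -1 < p 0 ∧ p 0 < 1 ∧ 0 < p 1 ∧ p 1 < 2 * Real.pi}

/-- The product metric `cosh² s (ds² + dt²) + dx²` of `N × ℝ`, where `N` is the catenoid with its
induced metric. -/
def catenoidMetric (p : Euc 3) : Matrix (Fin 3) (Fin 3) ℝ :=
  Matrix.diagonal ![Real.cosh (p 0) ^ 2, Real.cosh (p 0) ^ 2, 1]

/-- Catenoid × ℝ: `(s, t, x) ↦ (cosh s cos t, cosh s sin t, s, x)`. -/
def catenoidLine (p : Euc 3) : Euc 4 :=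
  !₂[Real.cosh (p 0) * Real.cos (p 1), Real.cosh (p 0) * Real.sin (p 1), p 0, p 2]

/-- Helicoid × ℝ: `(u, v, x) ↦ (u cos v, u sin v, v, x)`. -/
def helicoidLine (p : Euc 3) : Euc 4 :=
  !₂[p 0 * Real.cos (p 1), p 0 * Real.sin (p 1), p 1, p 2]

/-- The change of parameters `(s, t, x) ↦ (u, v, x) = (sinh s, t, x)`. -/
def toHelicoid (p : Euc 3) : Euc 3 :=
  !₂[Real.sinh (p 0), p 1, p 2]

end IdealHypersurface

end

open IdealHypersurface

open IdealHypersurface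

namespace IdealHypersurface

/-! The metric is the product of a line with a surface of Gauss curvature `-(cosh s)⁻⁴`. The
curvature of a plane is this number times the squared cosine of its angle with the surface
direction, so `inf K` is attained on the surface plane, and the three curvatures of an orthonormal
basis add up to the same number. Hence `δ_M = 0` everywhere (`hasDeltaAt_catenoidMetric`), and
minimality alone makes an isometric immersion of this metric ideal.

Catenoid and helicoid are conjugate members of one associated family: they share the metric, while
their second fundamental forms `a ds² + 2b ds dt - a dt²` have `(a, b)` a quarter turn apart on the
unit circle. `HasGaussFrame` records this common structure. The form is trace-free, which gives
minimality, and the shape operator is a multiple of a reflection plus `0` along the line, with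
eigenvalues `0, ±(cosh s)⁻²`.

An ambient isometry preserves distances between image points. Comparing one pair of points shows
that the two maps are not congruent, so each refutes the rigidity of the other. -/

theorem pderiv_comp_coord {n : ℕ} {φ : ℝ → ℝ} {φ' : ℝ} (i j : Fin n) (p : Euc n)
    (h : HasDerivAt φ φ' (p j)) :
    pderiv i (fun q => φ (q j)) p = if i = j then φ' else 0 := by
  have hj : HasFDerivAt (fun q : Euc n => q j) (EuclideanSpace.proj j : Euc n →L[ℝ] ℝ) p :=
    (EuclideanSpace.proj j : Euc n →L[ℝ] ℝ).hasFDerivAt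
  have := h.comp_hasFDerivAt p hj
  simp only [Function.comp_def] at this
  rw [pderiv, this.fderiv]
  simp [coordVec, eq_comm]

theorem pderiv_const {n : ℕ} (i : Fin n) (c : ℝ) (p : Euc n) :
    pderiv i (fun _ => c) p = 0 := by
  simp [pderiv]

/-! ### The metric -/

theorem metricInner_catenoidMetric (p X Y : Euc 3) :
    metricInner catenoidMetric p X Y
      = Real.cosh (p 0) ^ 2 * (X 0 * Y 0 + X 1 * Y 1) + X 2 * Y 2 := by
  simp [metricInner, catenoidMetric, Fin.sum_univ_three, Matrix.diagonal]
  ring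

theorem catenoidMetric_inv (p : Euc 3) :
    (catenoidMetric p)⁻¹
      = Matrix.diagonal ![(Real.cosh (p 0) ^ 2)⁻¹, (Real.cosh (p 0) ^ 2)⁻¹, 1] := by
  have h := (Real.cosh_pos (p 0)).ne'
  refine Matrix.inv_eq_right_inv ?_
  rw [catenoidMetric, Matrix.diagonal_mul_diagonal, ← Matrix.diagonal_one]
  congr 1
  funext i
  fin_cases i <;> simp [h]

theorem pderiv_catenoidMetric (i j l : Fin 3) (p : Euc 3) :
    pderiv i (fun q => catenoidMetric q j l) p
      = if i = 0 ∧ j = l ∧ l ≠ 2 then 2 * Real.cosh (p 0) * Real.sinh (p 0) else 0 := by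
  have key : HasDerivAt (fun s => Real.cosh s ^ 2) (2 * Real.cosh (p 0) * Real.sinh (p 0)) (p 0) := by
    simpa [Function.comp_def] using (Real.hasDerivAt_cosh (p 0)).fun_pow 2
  have h1 := pderiv_comp_coord i 0 p key
  have h2 := pderiv_const i 0 p
  have h3 := pderiv_const i 1 p
  fin_cases j <;> fin_cases l <;> simp [catenoidMetric, Matrix.diagonal, h1, h2, h3]

/-- The Christoffel symbols of the metric `cosh² s (ds² + dt²) + dx²`, divided by `tanh s`. -/
def catenoidChristoffel : Fin 3 → Fin 3 → Fin 3 → ℝ :=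
  ![![![1, 0, 0], ![0, -1, 0], ![0, 0, 0]], ![![0, 1, 0], ![1, 0, 0], ![0, 0, 0]],
    ![![0, 0, 0], ![0, 0, 0], ![0, 0, 0]]]

theorem christoffel_catenoidMetric (k i j : Fin 3) :
    christoffel catenoidMetric k i j
      = fun p => catenoidChristoffel k i j * Real.tanh (p 0) := by
  funext p
  have h := (Real.cosh_pos (p 0)).ne'
  simp only [christoffel, pderiv_catenoidMetric, catenoidMetric_inv, Real.tanh_eq_sinh_div_cosh]
  fin_cases k <;> fin_cases i <;> fin_cases j <;>
    simp [Fin.sum_univ_three, Matrix.diagonal, catenoidChristoffel] <;> field_simp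

theorem hasDerivAt_tanh (s : ℝ) : HasDerivAt Real.tanh ((Real.cosh s ^ 2)⁻¹) s := by
  have h := (Real.cosh_pos s).ne'
  have := (Real.hasDerivAt_sinh s).div (Real.hasDerivAt_cosh s) h
  have e : Real.tanh = Real.sinh / Real.cosh := by
    funext x; exact Real.tanh_eq_sinh_div_cosh x
  rw [e]
  refine this.congr_deriv ?_
  have := Real.cosh_sq s
  field_simp
  linarith

/-- The standard area form of the first two coordinates. -/
def planeArea : Fin 3 → Fin 3 → ℝ := ![![0, 1, 0], ![-1, 0, 0], ![0, 0, 0]]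

/-- Only the conformal surface factor contributes. Its curvature is linear in the second derivatives
of `log cosh`, so the terms quadratic in `tanh` cancel and `tanh' = cosh⁻²` remains. -/
theorem curvatureCoeff_catenoidMetric (l k i j : Fin 3) (p : Euc 3) :
    curvatureCoeff catenoidMetric l k i j p
      = -(planeArea i j * planeArea l k * (Real.cosh (p 0) ^ 2)⁻¹) := by
  have hd : ∀ c : ℝ, ∀ i : Fin 3, pderiv i (fun q : Euc 3 => c * Real.tanh (q 0)) p
      = if i = 0 then c * (Real.cosh (p 0) ^ 2)⁻¹ else 0 := fun c i =>
    pderiv_comp_coord i 0 p ((hasDerivAt_tanh (p 0)).const_mul c)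
  simp only [curvatureCoeff, christoffel_catenoidMetric, hd, Fin.sum_univ_three]
  generalize Real.tanh (p 0) = T
  generalize (Real.cosh (p 0) ^ 2)⁻¹ = C
  fin_cases l <;> fin_cases k <;> fin_cases i <;> fin_cases j <;>
    simp [catenoidChristoffel, planeArea]

theorem riemann_catenoidMetric (p X Y : Euc 3) :
    riemann catenoidMetric p X Y Y X = -(X 0 * Y 1 - X 1 * Y 0) ^ 2 := by
  have h := (Real.cosh_pos (p 0)).ne'
  simp only [riemann, curvatureCoeff_catenoidMetric]
  simp [Fin.sum_univ_three, planeArea, catenoidMetric, Matrix.diagonal]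
  field_simp
  ring

theorem sectionalCurvature_catenoidMetric (p X Y : Euc 3) :
    sectionalCurvature catenoidMetric p X Y = -(X 0 * Y 1 - X 1 * Y 0) ^ 2 /
      (metricInner catenoidMetric p X X * metricInner catenoidMetric p Y Y
        - metricInner catenoidMetric p X Y ^ 2) := by
  rw [sectionalCurvature, riemann_catenoidMetric]

/-! ### Infimum of the sectional curvatures, scalar curvature and `δ_M` -/

theorem isLeast_sectionalCurvatures_catenoidMetric (p : Euc 3) :
    IsLeast (sectionalCurvatures catenoidMetric p) (-(Real.cosh (p 0) ^ 4)⁻¹) := by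
  have h := Real.cosh_pos (p 0)
  constructor
  · refine ⟨coordVec 0, coordVec 1, ?_, ?_⟩
    · rw [LinearIndependent.pair_iff]
      intro s t hst
      have h0 := congrArg (fun v : Euc 3 => v 0) hst
      have h1 := congrArg (fun v : Euc 3 => v 1) hst
      simp [coordVec] at h0 h1
      exact ⟨h0, h1⟩
    · simp [sectionalCurvature_catenoidMetric, metricInner_catenoidMetric, coordVec]
      field_simp
  · rintro _ ⟨X, Y, -, rfl⟩
    rw [sectionalCurvature_catenoidMetric]
    -- Lagrange's identity: the Gram determinant is a weighted sum of squared minors, and only the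
    -- first of these minors enters the numerator of the curvature.
    have hG : metricInner catenoidMetric p X X * metricInner catenoidMetric p Y Y
        - metricInner catenoidMetric p X Y ^ 2
        = Real.cosh (p 0) ^ 4 * (X 0 * Y 1 - X 1 * Y 0) ^ 2
          + Real.cosh (p 0) ^ 2 * ((X 0 * Y 2 - X 2 * Y 0) ^ 2 + (X 1 * Y 2 - X 2 * Y 1) ^ 2) := by
      simp only [metricInner_catenoidMetric]
      ring
    rw [hG, neg_div, neg_le_neg_iff]
    refine div_le_of_le_mul₀ (by positivity) (by positivity) ?_
    rw [mul_add, inv_mul_cancel_left₀ (by positivity)]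
    exact le_add_of_nonneg_right (by positivity)

theorem hasScalarCurvatureAt_catenoidMetric (p : Euc 3) :
    HasScalarCurvatureAt catenoidMetric p (-(Real.cosh (p 0) ^ 4)⁻¹) := by
  have h := Real.cosh_pos (p 0)
  constructor
  · refine ⟨![(Real.cosh (p 0))⁻¹ • coordVec 0, (Real.cosh (p 0))⁻¹ • coordVec 1, coordVec 2], ?_⟩
    intro a b
    rw [metricInner_catenoidMetric]
    fin_cases a <;> fin_cases b <;> simp [coordVec] <;> field_simp
  · intro e he
    set c := Real.cosh (p 0) with hc
    -- The rows are the frame vectors in the orthonormal basis `∂_s/c, ∂_t/c, ∂_x`. Orthonormal rows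
    -- force orthonormal columns.
    let P : Matrix (Fin 3) (Fin 3) ℝ := Matrix.of fun a i => ![c, c, 1] i * e a i
    have hP : P * P.transpose = 1 := by
      ext a b
      have := he a b
      rw [metricInner_catenoidMetric] at this
      rw [Matrix.mul_apply, Matrix.one_apply, ← this]
      simp [P, Fin.sum_univ_three]
      ring
    have hP' := mul_eq_one_comm.1 hP
    have h00 := congrFun (congrFun hP' 0) 0
    have h01 := congrFun (congrFun hP' 0) 1
    have h11 := congrFun (congrFun hP' 1) 1
    simp [P, Matrix.mul_apply, Fin.sum_univ_three] at h00 h01 h11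
    have hK : ∀ a b, a < b → sectionalCurvature catenoidMetric p (e a) (e b)
        = -(e a 0 * e b 1 - e a 1 * e b 0) ^ 2 := by
      intro a b hab
      rw [sectionalCurvature_catenoidMetric, he, he, he]
      simp [hab.ne]
    have hS : ∑ a, ∑ b ∈ Finset.univ.filter (fun b => a < b),
        sectionalCurvature catenoidMetric p (e a) (e b)
        = sectionalCurvature catenoidMetric p (e 0) (e 1)
          + sectionalCurvature catenoidMetric p (e 0) (e 2)
          + sectionalCurvature catenoidMetric p (e 1) (e 2) := by
      simp [Finset.sum_filter, Fin.sum_univ_three]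
    rw [hS, hK 0 1 (by decide), hK 0 2 (by decide), hK 1 2 (by decide)]
    field_simp
    -- By Lagrange's identity the squared minors of the first two columns of `P` sum to their Gram
    -- determinant, which is `1`.
    linear_combination (-1) * (c * e 0 1 * (c * e 0 1) + c * e 1 1 * (c * e 1 1)
      + c * e 2 1 * (c * e 2 1)) * h00 - h11 +
      (c * e 0 0 * (c * e 0 1) + c * e 1 0 * (c * e 1 1) + c * e 2 0 * (c * e 2 1)) * h01

theorem hasDeltaAt_catenoidMetric (p : Euc 3) : HasDeltaAt catenoidMetric p 0 :=
  ⟨_, _, hasScalarCurvatureAt_catenoidMetric p,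
    (isLeast_sectionalCurvatures_catenoidMetric p).isGLB, (sub_self _).symm⟩

theorem isRiemannianDomain_catenoid : IsRiemannianDomain catenoidDomain catenoidMetric where
  isOpen := by
    have hc : ∀ i : Fin 3, Continuous fun p : Euc 3 => p i := fun i => by fun_prop
    exact (isOpen_lt continuous_const (hc 0)).inter <| (isOpen_lt (hc 0) continuous_const).inter <|
      (isOpen_lt continuous_const (hc 1)).inter (isOpen_lt (hc 1) continuous_const)
  isConnected := by
    have h1 : 0 < Real.arsinh 1 := Real.arsinh_pos_iff.2 one_pos
    refine ⟨⟨!₂[0, Real.pi, 0], ?_⟩, ?_⟩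
    · simp [catenoidDomain, h1, Real.pi_pos]
    · have hl : ∀ i : Fin 3, IsLinearMap ℝ fun p : Euc 3 => p i := fun i => ⟨by simp, by simp⟩
      exact Convex.isPreconnected <| (convex_halfSpace_gt (hl 0) _).inter <|
        (convex_halfSpace_lt (hl 0) _).inter <|
        (convex_halfSpace_gt (hl 1) _).inter (convex_halfSpace_lt (hl 1) _)
  smooth := by
    intro i j
    have h : ContDiff ℝ ∞ fun p : Euc 3 => Real.cosh (p 0) ^ 2 :=
      (Real.contDiff_cosh.comp (by fun_prop)).pow 2
    refine ContDiff.contDiffOn ?_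
    fin_cases i <;> fin_cases j <;> simp [catenoidMetric, Matrix.diagonal, h, contDiff_const]
  posDef := by
    intro p _
    refine Matrix.PosDef.diagonal ?_
    intro i
    have h := Real.cosh_pos (p 0)
    fin_cases i <;> simp [h]

/-! ### Associated immersions -/

/-- `f` is an isometric immersion of the metric `cosh² s (ds² + dt²) + dx²` with coordinate vector
fields `U`, `V`, `W`, unit normal `N` and second fundamental form
`(a ds² + 2 b ds dt - a dt²) N`, where `a² + b² = 1`. -/
structure HasGaussFrame (f : Euc 3 → Euc 4) (a b : ℝ) (U V N : Euc 3 → Euc 4) (W : Euc 4) :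
    Prop where
  sq_add_sq : a ^ 2 + b ^ 2 = 1
  contDiff : ContDiff ℝ ∞ f
  differentiable_U : Differentiable ℝ U
  differentiable_V : Differentiable ℝ V
  fderiv_apply : ∀ p X, fderiv ℝ f p X = X 0 • U p + X 1 • V p + X 2 • W
  fderiv_U : ∀ p X, fderiv ℝ U p X =
    (Real.tanh (p 0) * X 0) • U p + (Real.tanh (p 0) * X 1) • V p + (a * X 0 + b * X 1) • N p
  fderiv_V : ∀ p X, fderiv ℝ V p X =
    (-(Real.tanh (p 0) * X 1)) • U p + (Real.tanh (p 0) * X 0) • V p + (b * X 0 - a * X 1) • N p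
  inner_U_U : ∀ p, ⟪U p, U p⟫ = Real.cosh (p 0) ^ 2
  inner_V_V : ∀ p, ⟪V p, V p⟫ = Real.cosh (p 0) ^ 2
  inner_W_W : ⟪W, W⟫ = (1 : ℝ)
  inner_U_V : ∀ p, ⟪U p, V p⟫ = 0
  inner_U_W : ∀ p, ⟪U p, W⟫ = 0
  inner_V_W : ∀ p, ⟪V p, W⟫ = 0
  inner_U_N : ∀ p, ⟪U p, N p⟫ = 0
  inner_V_N : ∀ p, ⟪V p, N p⟫ = 0
  inner_W_N : ∀ p, ⟪W, N p⟫ = 0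
  norm_N : ∀ p, ‖N p‖ = 1

namespace HasGaussFrame

variable {f : Euc 3 → Euc 4} {a b : ℝ} {U V N : Euc 3 → Euc 4} {W : Euc 4}

theorem isIsometricImmersion (h : HasGaussFrame f a b U V N W) (Ω : Set (Euc 3)) :
    IsIsometricImmersion Ω catenoidMetric f where
  smooth := h.contDiff.contDiffOn
  isometric p _ X Y := by
    have h1 := h.inner_U_V p
    have h2 := h.inner_U_W p
    have h3 := h.inner_V_W p
    rw [metricInner_catenoidMetric, h.fderiv_apply, h.fderiv_apply]
    simp only [inner_add_left, inner_add_right, inner_smul_left, inner_smul_right,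
      h1, h2, h3, h.inner_U_U, h.inner_V_V, h.inner_W_W, real_inner_comm (U p) (V p),
      real_inner_comm (U p) W, real_inner_comm (V p) W]
    simp
    ring

theorem normal_mem (h : HasGaussFrame f a b U V N W) (p : Euc 3) : N p ∈ normalSpace f p := by
  rw [normalSpace, Submodule.mem_orthogonal]
  rintro _ ⟨X, rfl⟩
  simp [h.fderiv_apply, inner_add_left, inner_smul_left, h.inner_U_N, h.inner_V_N, h.inner_W_N]

theorem secondFundamentalForm_eq (h : HasGaussFrame f a b U V N W) (p X Y : Euc 3) :
    secondFundamentalForm f p X Y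
      = (a * X 0 * Y 0 + b * (X 0 * Y 1 + X 1 * Y 0) - a * X 1 * Y 1) • N p := by
  have hY : (fun q => fderiv ℝ f q Y) = fun q => Y 0 • U q + Y 1 • V q + Y 2 • W :=
    funext fun q => h.fderiv_apply q Y
  have hU := (h.differentiable_U p).hasFDerivAt
  have hV := (h.differentiable_V p).hasFDerivAt
  rw [secondFundamentalForm, hY,
    (((hU.fun_const_smul (Y 0)).fun_add (hV.fun_const_smul (Y 1))).add_const (Y 2 • W)).fderiv]
  -- The Christoffel terms `Γ(X, Y)`: the tangential part of the second derivative is the image of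
  -- `Z` under the differential of `f`.
  let Z : Euc 3 := !₂[Real.tanh (p 0) * (X 0 * Y 0 - X 1 * Y 1),
    Real.tanh (p 0) * (X 1 * Y 0 + X 0 * Y 1), 0]
  refine Submodule.eq_starProjection_of_mem_orthogonal' (z := fderiv ℝ f p Z)
    (Submodule.smul_mem _ _ (h.normal_mem p)) ?_ ?_
  · exact Submodule.le_orthogonal_orthogonal _ ⟨Z, rfl⟩
  · simp [h.fderiv_apply, h.fderiv_U, h.fderiv_V, Z]
    module

theorem meanCurvatureVector_eq_zero (h : HasGaussFrame f a b U V N W) (p : Euc 3) :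
    meanCurvatureVector catenoidMetric f p = 0 := by
  simp only [meanCurvatureVector, h.secondFundamentalForm_eq, catenoidMetric_inv]
  simp [Fin.sum_univ_three, Matrix.diagonal, coordVec]

theorem isMinimal (h : HasGaussFrame f a b U V N W) (Ω : Set (Euc 3)) :
    IsMinimal Ω catenoidMetric f :=
  fun p _ => h.meanCurvatureVector_eq_zero p

theorem isIdeal (h : HasGaussFrame f a b U V N W) (Ω : Set (Euc 3)) :
    IsIdeal Ω catenoidMetric f := by
  intro p _
  rw [h.meanCurvatureVector_eq_zero p]
  simpa using hasDeltaAt_catenoidMetric p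

end HasGaussFrame

/-! ### Spectrum of the shape operator -/

/-- The endomorphism `c [[a, b], [b, -a]] ⊕ 0` of `ℝ² ⊕ ℝ`. -/
def planeReflection (a b c : ℝ) : Module.End ℝ (Euc 3) where
  toFun X := !₂[c * (a * X 0 + b * X 1), c * (b * X 0 - a * X 1), 0]
  map_add' X Y := by
    ext i
    fin_cases i <;> simp <;> ring
  map_smul' r X := by
    ext i
    fin_cases i <;> simp <;> ring

theorem planeReflection_apply (a b c : ℝ) (X : Euc 3) :
    planeReflection a b c X = !₂[c * (a * X 0 + b * X 1), c * (b * X 0 - a * X 1), 0] := rfl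

theorem hasEigenvalue_planeReflection {a b : ℝ} (hab : a ^ 2 + b ^ 2 = 1) (c : ℝ) :
    (planeReflection a b c).HasEigenvalue c := by
  -- A vector on the axis of the reflection. The half-angle choice `(1 + a, b)` vanishes exactly
  -- when `a = -1`, where `(0, 1)` serves.
  have key : ∃ x y : ℝ, (x ≠ 0 ∨ y ≠ 0) ∧ a * x + b * y = x ∧ b * x - a * y = y := by
    by_cases h : 1 + a = 0
    · have ha : a = -1 := by linarith
      have hb : b = 0 := by
        rw [ha] at hab
        nlinarith
      exact ⟨0, 1, by simp, by simp [hb], by simp [ha]⟩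
    · exact ⟨1 + a, b, Or.inl h, by linear_combination hab, by ring⟩
  obtain ⟨x, y, hxy, h0, h1⟩ := key
  refine Module.End.hasEigenvalue_of_hasEigenvector (x := !₂[x, y, 0])
    ⟨Module.End.mem_eigenspace_iff.2 ?_, fun h => ?_⟩
  · rw [planeReflection_apply]
    ext i
    fin_cases i <;> simp [h0, h1]
  · have hx := congrArg (fun v : Euc 3 => v 0) h
    have hy := congrArg (fun v : Euc 3 => v 1) h
    simp at hx hy
    simp [hx, hy] at hxy

theorem setOf_hasEigenvalue_planeReflection {a b : ℝ} (hab : a ^ 2 + b ^ 2 = 1) (c : ℝ) :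
    {κ : ℝ | (planeReflection a b c).HasEigenvalue κ} = {0, c, -c} := by
  -- This symmetry turns the eigenvalue statement for `c` into the one for `-c`.
  have hneg : planeReflection a b c = planeReflection (-a) (-b) (-c) := by
    ext X i
    fin_cases i <;> simp [planeReflection_apply] <;> ring
  ext κ
  simp only [Set.mem_ofPred_eq, Set.mem_insert_iff, Set.mem_singleton_iff]
  constructor
  · intro hκ
    obtain ⟨X, hX, hX0⟩ := hκ.exists_hasEigenvector
    rw [Module.End.mem_eigenspace_iff, planeReflection_apply] at hX
    have h0 := congrArg (fun v : Euc 3 => v 0) hX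
    have h1 := congrArg (fun v : Euc 3 => v 1) hX
    have h2 := congrArg (fun v : Euc 3 => v 2) hX
    simp at h0 h1 h2
    by_cases hc : κ = 0 ∨ κ = c ∨ κ = -c
    · exact hc
    exfalso
    push Not at hc
    have hne : c ^ 2 - κ ^ 2 ≠ 0 := by
      intro h
      rcases sq_eq_sq_iff_eq_or_eq_neg.1 (sub_eq_zero.1 h).symm with h | h
      · exact hc.2.1 h
      · exact hc.2.2 h
    -- The square of the operator is `c²` on the plane, so applying it twice to an eigenvector
    -- compares `c²` with `κ²`.
    have e0 : (c ^ 2 - κ ^ 2) * X 0 = 0 := by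
      linear_combination κ * h0 + c * a * h0 + c * b * h1 - c ^ 2 * X 0 * hab
    have e1 : (c ^ 2 - κ ^ 2) * X 1 = 0 := by
      linear_combination κ * h1 + c * b * h0 - c * a * h1 - c ^ 2 * X 1 * hab
    have z0 := (mul_eq_zero.1 e0).resolve_left hne
    have z1 := (mul_eq_zero.1 e1).resolve_left hne
    have z2 := h2.resolve_left hc.1
    refine hX0 ?_
    ext i
    fin_cases i <;> simp [z0, z1, z2]
  · rintro (rfl | rfl | rfl)
    · refine Module.End.hasEigenvalue_of_hasEigenvector (x := !₂[0, 0, 1])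
        ⟨Module.End.mem_eigenspace_iff.2 ?_, fun h => ?_⟩
      · rw [planeReflection_apply]
        ext i
        fin_cases i <;> simp
      · simpa using congrArg (fun v : Euc 3 => v 2) h
    · exact hasEigenvalue_planeReflection hab κ
    · rw [hneg]
      exact hasEigenvalue_planeReflection (by simpa using hab) (-c)

theorem HasGaussFrame.hasDistinctPrincipalCurvatures {f : Euc 3 → Euc 4} {a b : ℝ}
    {U V N : Euc 3 → Euc 4} {W : Euc 4} (h : HasGaussFrame f a b U V N W) (Ω : Set (Euc 3)) :
    HasDistinctPrincipalCurvatures Ω catenoidMetric f 3 := by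
  intro p _
  have hc := Real.cosh_pos (p 0)
  refine ⟨N p, h.normal_mem p, h.norm_N p, planeReflection a b (Real.cosh (p 0) ^ 2)⁻¹, ?_, ?_⟩
  · intro X Y
    rw [h.secondFundamentalForm_eq, inner_smul_left, real_inner_self_eq_norm_sq, h.norm_N,
      metricInner_catenoidMetric, planeReflection_apply]
    simp
    field_simp
    ring
  · rw [setOf_hasEigenvalue_planeReflection h.sq_add_sq]
    have hpos : 0 < (Real.cosh (p 0) ^ 2)⁻¹ := by positivity
    rw [Set.ncard_eq_three]
    exact ⟨_, _, _, hpos.ne, by linarith, by linarith, rfl⟩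

/-! ### The catenoid and the helicoid -/

theorem hasFDerivAt_of_coords {n m : ℕ} {f : Euc n → Euc m} {p : Euc n}
    {L : Fin m → Euc n →L[ℝ] ℝ} (h : ∀ i, HasFDerivAt (fun q => f q i) (L i) p) (X : Euc n) :
    fderiv ℝ f p X = WithLp.toLp 2 fun i => L i X := by
  have hf : DifferentiableAt ℝ f p := differentiableAt_euclidean.2 fun i => (h i).differentiableAt
  ext i
  have h' := (EuclideanSpace.proj i : Euc m →L[ℝ] ℝ).hasFDerivAt.comp p hf.hasFDerivAt
  have := h'.unique (h i)
  simpa using congrArg (fun T => T X) this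

theorem hasFDerivAt_coord {n : ℕ} (i : Fin n) (p : Euc n) :
    HasFDerivAt (fun q : Euc n => q i) (EuclideanSpace.proj i : Euc n →L[ℝ] ℝ) p :=
  (EuclideanSpace.proj i : Euc n →L[ℝ] ℝ).hasFDerivAt

/-- The derivative of `(s, t, x) ↦ (φ₀(s) ψ₀(t), φ₁(s) ψ₁(t), χ(s, t), ω x)`. -/
theorem fderiv_of_separated {φ₀ ψ₀ φ₁ ψ₁ : ℝ → ℝ} {φ₀' ψ₀' φ₁' ψ₁' : ℝ} {p : Euc 3}
    (k₀ k₁ k₂ c : ℝ) (h₁ : HasDerivAt φ₀ φ₀' (p 0)) (h₂ : HasDerivAt ψ₀ ψ₀' (p 1))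
    (h₃ : HasDerivAt φ₁ φ₁' (p 0)) (h₄ : HasDerivAt ψ₁ ψ₁' (p 1)) (X : Euc 3) :
    fderiv ℝ (fun q : Euc 3 => (!₂[φ₀ (q 0) * ψ₀ (q 1), φ₁ (q 0) * ψ₁ (q 1),
        k₀ * q 0 + k₁ * q 1 + c, k₂ * q 2] : Euc 4)) p X
      = !₂[φ₀' * ψ₀ (p 1) * X 0 + φ₀ (p 0) * ψ₀' * X 1,
          φ₁' * ψ₁ (p 1) * X 0 + φ₁ (p 0) * ψ₁' * X 1, k₀ * X 0 + k₁ * X 1, k₂ * X 2] := by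
  have d0 := hasFDerivAt_coord 0 p
  have d1 := hasFDerivAt_coord 1 p
  have d2 := hasFDerivAt_coord 2 p
  have c0 := (h₁.comp_hasFDerivAt p d0).fun_mul (h₂.comp_hasFDerivAt p d1)
  have c1 := (h₃.comp_hasFDerivAt p d0).fun_mul (h₄.comp_hasFDerivAt p d1)
  have c2 := ((d0.const_mul k₀).fun_add (d1.const_mul k₁)).add_const c
  have c3 := d2.const_mul k₂
  rw [hasFDerivAt_of_coords (L := ![_, _, _, _]) (p := p)]
  rotate_left
  · intro i
    fin_cases i
    · exact c0
    · exact c1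
    · exact c2
    · exact c3
  ext i
  fin_cases i <;> simp <;> ring

theorem cosh_ne_zero (s : ℝ) : Real.cosh s ≠ 0 := (Real.cosh_pos s).ne'

theorem hasGaussFrame_catenoidLine :
    HasGaussFrame catenoidLine 1 0
      (fun p => !₂[Real.sinh (p 0) * Real.cos (p 1), Real.sinh (p 0) * Real.sin (p 1), 1, 0])
      (fun p => !₂[-(Real.cosh (p 0) * Real.sin (p 1)), Real.cosh (p 0) * Real.cos (p 1), 0, 0])
      (fun p => (Real.cosh (p 0))⁻¹ • !₂[Real.cos (p 1), Real.sin (p 1), -Real.sinh (p 0), 0])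
      !₂[0, 0, 0, 1] where
  sq_add_sq := by norm_num
  contDiff := by
    refine contDiff_euclidean.2 fun i => ?_
    fin_cases i <;> simp [catenoidLine] <;> fun_prop
  differentiable_U := by
    refine differentiable_euclidean.2 fun i => ?_
    fin_cases i <;> simp <;> fun_prop
  differentiable_V := by
    refine differentiable_euclidean.2 fun i => ?_
    fin_cases i <;> simp <;> fun_prop
  fderiv_apply p X := by
    have := fderiv_of_separated 1 0 1 0 (Real.hasDerivAt_cosh (p 0)) (Real.hasDerivAt_cos (p 1))
      (Real.hasDerivAt_cosh (p 0)) (Real.hasDerivAt_sin (p 1)) X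
    simp only [one_mul, zero_mul, add_zero] at this
    unfold catenoidLine
    rw [this]
    ext i
    fin_cases i <;> simp <;> ring
  fderiv_U p X := by
    -- The last constant `1` is the third coordinate of `U`.
    have := fderiv_of_separated 0 0 0 1 (Real.hasDerivAt_sinh (p 0)) (Real.hasDerivAt_cos (p 1))
      (Real.hasDerivAt_sinh (p 0)) (Real.hasDerivAt_sin (p 1)) X
    simp only [zero_mul, zero_add] at this
    rw [this]
    have hc := cosh_ne_zero (p 0)
    have hs := Real.cosh_sq (p 0)
    ext i
    fin_cases i <;> simp [Real.tanh_eq_sinh_div_cosh] <;> field_simp <;> grind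
  fderiv_V p X := by
    have := fderiv_of_separated 0 0 0 0 (Real.hasDerivAt_cosh (p 0))
      (Real.hasDerivAt_sin (p 1)).neg
      (Real.hasDerivAt_cosh (p 0)) (Real.hasDerivAt_cos (p 1)) X
    simp only [zero_mul, zero_add, Pi.neg_apply, mul_neg] at this
    rw [this]
    have hc := cosh_ne_zero (p 0)
    have hs := Real.cosh_sq (p 0)
    ext i
    fin_cases i <;> simp [Real.tanh_eq_sinh_div_cosh] <;> field_simp <;> grind
  inner_U_U p := by
    have := Real.sin_sq_add_cos_sq (p 1)
    have := Real.cosh_sq (p 0)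
    rw [PiLp.inner_apply, Fin.sum_univ_four]
    simp
    grind
  inner_V_V p := by
    have := Real.sin_sq_add_cos_sq (p 1)
    rw [PiLp.inner_apply, Fin.sum_univ_four]
    simp
    grind
  inner_W_W := by
    rw [PiLp.inner_apply, Fin.sum_univ_four]
    simp
  inner_U_V p := by
    rw [PiLp.inner_apply, Fin.sum_univ_four]
    simp
    ring
  inner_U_W p := by simp [PiLp.inner_apply, Fin.sum_univ_four]
  inner_V_W p := by simp [PiLp.inner_apply, Fin.sum_univ_four]
  inner_U_N p := by
    have := Real.sin_sq_add_cos_sq (p 1)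
    rw [PiLp.inner_apply, Fin.sum_univ_four]
    simp
    grind
  inner_V_N p := by
    rw [PiLp.inner_apply, Fin.sum_univ_four]
    simp
    ring
  inner_W_N p := by simp [PiLp.inner_apply, Fin.sum_univ_four]
  norm_N p := by
    have hc := Real.cosh_pos (p 0)
    have h2 := Real.cosh_sq (p 0)
    rw [norm_smul, EuclideanSpace.norm_eq]
    simp [Fin.sum_univ_four, abs_of_pos hc]
    rw [add_comm, ← h2, Real.sqrt_sq hc.le, inv_mul_cancel₀ hc.ne']

theorem hasGaussFrame_helicoidLine :
    HasGaussFrame (helicoidLine ∘ toHelicoid) 0 (-1)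
      (fun p => !₂[Real.cosh (p 0) * Real.cos (p 1), Real.cosh (p 0) * Real.sin (p 1), 0, 0])
      (fun p => !₂[-(Real.sinh (p 0) * Real.sin (p 1)), Real.sinh (p 0) * Real.cos (p 1), 1, 0])
      (fun p => (Real.cosh (p 0))⁻¹ • !₂[Real.sin (p 1), -Real.cos (p 1), Real.sinh (p 0), 0])
      !₂[0, 0, 0, 1] where
  sq_add_sq := by norm_num
  contDiff := by
    refine contDiff_euclidean.2 fun i => ?_
    fin_cases i <;> simp [helicoidLine, toHelicoid] <;> fun_prop
  differentiable_U := by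
    refine differentiable_euclidean.2 fun i => ?_
    fin_cases i <;> simp <;> fun_prop
  differentiable_V := by
    refine differentiable_euclidean.2 fun i => ?_
    fin_cases i <;> simp <;> fun_prop
  fderiv_apply p X := by
    have := fderiv_of_separated 0 1 1 0 (Real.hasDerivAt_sinh (p 0)) (Real.hasDerivAt_cos (p 1))
      (Real.hasDerivAt_sinh (p 0)) (Real.hasDerivAt_sin (p 1)) X
    have he : helicoidLine ∘ toHelicoid = fun q : Euc 3 =>
        !₂[Real.sinh (q 0) * Real.cos (q 1), Real.sinh (q 0) * Real.sin (q 1), q 1, q 2] := by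
      funext q
      simp [helicoidLine, toHelicoid]
    simp only [one_mul, zero_mul, add_zero, zero_add] at this
    rw [he, this]
    ext i
    fin_cases i <;> simp <;> ring
  fderiv_U p X := by
    have := fderiv_of_separated 0 0 0 0 (Real.hasDerivAt_cosh (p 0)) (Real.hasDerivAt_cos (p 1))
      (Real.hasDerivAt_cosh (p 0)) (Real.hasDerivAt_sin (p 1)) X
    simp only [zero_mul, zero_add] at this
    rw [this]
    have hc := cosh_ne_zero (p 0)
    have hs := Real.cosh_sq (p 0)
    ext i
    fin_cases i <;> simp [Real.tanh_eq_sinh_div_cosh] <;> field_simp <;> grind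
  fderiv_V p X := by
    have := fderiv_of_separated 0 0 0 1 (Real.hasDerivAt_sinh (p 0))
      (Real.hasDerivAt_sin (p 1)).neg
      (Real.hasDerivAt_sinh (p 0)) (Real.hasDerivAt_cos (p 1)) X
    simp only [zero_mul, zero_add, Pi.neg_apply, mul_neg] at this
    rw [this]
    have hc := cosh_ne_zero (p 0)
    have hs := Real.cosh_sq (p 0)
    ext i
    fin_cases i <;> simp [Real.tanh_eq_sinh_div_cosh] <;> field_simp <;> grind
  inner_U_U p := by
    have := Real.sin_sq_add_cos_sq (p 1)
    rw [PiLp.inner_apply, Fin.sum_univ_four]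
    simp
    grind
  inner_V_V p := by
    have := Real.sin_sq_add_cos_sq (p 1)
    have := Real.cosh_sq (p 0)
    rw [PiLp.inner_apply, Fin.sum_univ_four]
    simp
    grind
  inner_W_W := by
    rw [PiLp.inner_apply, Fin.sum_univ_four]
    simp
  inner_U_V p := by
    rw [PiLp.inner_apply, Fin.sum_univ_four]
    simp
    ring
  inner_U_W p := by simp [PiLp.inner_apply, Fin.sum_univ_four]
  inner_V_W p := by simp [PiLp.inner_apply, Fin.sum_univ_four]
  inner_U_N p := by
    rw [PiLp.inner_apply, Fin.sum_univ_four]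
    simp
    ring
  inner_V_N p := by
    have := Real.sin_sq_add_cos_sq (p 1)
    rw [PiLp.inner_apply, Fin.sum_univ_four]
    simp
    grind
  inner_W_N p := by simp [PiLp.inner_apply, Fin.sum_univ_four]
  norm_N p := by
    have hc := Real.cosh_pos (p 0)
    have h2 := Real.cosh_sq (p 0)
    rw [norm_smul, EuclideanSpace.norm_eq]
    simp [Fin.sum_univ_four, abs_of_pos hc]
    rw [add_comm, ← h2, Real.sqrt_sq hc.le, inv_mul_cancel₀ hc.ne']

/-! ### Change of parameters and injectivity -/

theorem bijOn_toHelicoid : Set.BijOn toHelicoid catenoidDomain helicoidDomain := by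
  refine ⟨?_, ?_, ?_⟩
  · rintro p ⟨h1, h2, h3, h4⟩
    have e1 := Real.sinh_lt_sinh.2 h1
    have e2 := Real.sinh_lt_sinh.2 h2
    rw [Real.sinh_neg, Real.sinh_arsinh] at e1
    rw [Real.sinh_arsinh] at e2
    exact ⟨by simpa [toHelicoid] using e1, by simpa [toHelicoid] using e2,
      by simpa [toHelicoid] using h3, by simpa [toHelicoid] using h4⟩
  · intro p _ q _ h
    have h0 := congrArg (fun v : Euc 3 => v 0) h
    have h1 := congrArg (fun v : Euc 3 => v 1) h
    have h2 := congrArg (fun v : Euc 3 => v 2) h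
    simp [toHelicoid] at h0 h1 h2
    ext i
    fin_cases i <;> simp [h0, h1, h2]
  · rintro p ⟨h1, h2, h3, h4⟩
    refine ⟨!₂[Real.arsinh (p 0), p 1, p 2], ⟨?_, ?_, ?_, ?_⟩, ?_⟩
    · simpa [← Real.arsinh_neg] using h1
    · simpa using h2
    · simpa using h3
    · simpa using h4
    · ext i
      fin_cases i <;> simp [toHelicoid]

theorem eq_of_cos_eq_of_sin_eq {t t' : ℝ} (ht : 0 < t) (ht2 : t < 2 * Real.pi) (ht' : 0 < t')
    (ht2' : t' < 2 * Real.pi) (hc : Real.cos t = Real.cos t') (hs : Real.sin t = Real.sin t') :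
    t = t' := by
  have h : Real.cos (t - t') = 1 := by
    rw [Real.cos_sub, hc, hs]
    linarith [Real.sin_sq_add_cos_sq t']
  linarith [(Real.cos_eq_one_iff_of_lt_of_lt (by linarith) (by linarith)).1 h]

theorem injOn_catenoidLine : Set.InjOn catenoidLine catenoidDomain := by
  rintro p ⟨-, -, hp1, hp2⟩ q ⟨-, -, hq1, hq2⟩ h
  have h0 := congrArg (fun v : Euc 4 => v 0) h
  have h1 := congrArg (fun v : Euc 4 => v 1) h
  have h2 := congrArg (fun v : Euc 4 => v 2) h
  have h3 := congrArg (fun v : Euc 4 => v 3) h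
  simp [catenoidLine] at h0 h1 h2 h3
  rw [h2] at h0 h1
  have e := eq_of_cos_eq_of_sin_eq hp1 hp2 hq1 hq2 (mul_left_cancel₀ (cosh_ne_zero _) h0)
    (mul_left_cancel₀ (cosh_ne_zero _) h1)
  ext i
  fin_cases i <;> simp [h2, h3, e]

theorem injective_helicoidLine : Function.Injective helicoidLine := by
  intro p q h
  have h0 := congrArg (fun v : Euc 4 => v 0) h
  have h1 := congrArg (fun v : Euc 4 => v 1) h
  have h2 := congrArg (fun v : Euc 4 => v 2) h
  have h3 := congrArg (fun v : Euc 4 => v 3) h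
  simp only [helicoidLine, PiLp.toLp_apply, Matrix.cons_val] at h0 h1 h2 h3
  rw [h2] at h0 h1
  -- The equal heights give a common angle; projecting the planar part onto that direction recovers
  -- the signed radius.
  have e : p 0 = q 0 := by
    linear_combination Real.cos (q 1) * h0 + Real.sin (q 1) * h1
      - (p 0 - q 0) * Real.sin_sq_add_cos_sq (q 1)
  ext i
  fin_cases i <;> simp [h2, h3, e]

/-! ### Non-congruence -/

theorem AreCongruent.symm {n m : ℕ} {Ω : Set (Euc n)} {f₁ f₂ : Euc n → Euc m}
    (h : AreCongruent Ω f₁ f₂) : AreCongruent Ω f₂ f₁ := by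
  obtain ⟨F, hF⟩ := h
  exact ⟨F.symm, fun p hp => by rw [hF p hp, F.symm_apply_apply]⟩

/-- Take two points with `s = 0` and `t` differing by `π`. The catenoid sends them to antipodal
points of its unit neck circle, at distance `2`; the helicoid sends them to its axis, at distance
`π`. -/
theorem not_areCongruent_catenoidLine_helicoidLine :
    ¬ AreCongruent catenoidDomain catenoidLine (helicoidLine ∘ toHelicoid) := by
  rintro ⟨F, hF⟩
  have hpi := Real.pi_pos
  have ha : 0 < Real.arsinh 1 := Real.arsinh_pos_iff.2 one_pos
  have hp : (!₂[0, Real.pi / 2, 0] : Euc 3) ∈ catenoidDomain := by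
    refine ⟨?_, ?_, ?_, ?_⟩ <;> simp [ha] <;> linarith
  have hq : (!₂[0, Real.pi / 2 + Real.pi, 0] : Euc 3) ∈ catenoidDomain := by
    refine ⟨?_, ?_, ?_, ?_⟩ <;> simp [ha] <;> linarith
  have h := F.isometry.dist_eq (catenoidLine !₂[0, Real.pi / 2, 0])
    (catenoidLine !₂[0, Real.pi / 2 + Real.pi, 0])
  rw [← hF _ hp, ← hF _ hq, EuclideanSpace.dist_eq, EuclideanSpace.dist_eq,
    Real.sqrt_inj (by positivity) (by positivity)] at h
  simp [Fin.sum_univ_four, helicoidLine, toHelicoid, catenoidLine, Real.dist_eq,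
    Real.sin_add, Real.cos_add] at h
  nlinarith [Real.pi_gt_three]

end IdealHypersurface

theorem proposition5p2 :
    -- existence of non-rigid minimal ideal hypersurfaces with three distinct principal curvatures
    (∃ (Ω : Set (Euc 3)) (g : Euc 3 → Matrix (Fin 3) (Fin 3) ℝ) (f : Euc 3 → Euc 4),
      IsRiemannianDomain Ω g ∧ IsIsometricImmersion Ω g f ∧ IsMinimal Ω g f ∧ IsIdeal Ω g f ∧
        HasDistinctPrincipalCurvatures Ω g f 3 ∧ ¬ IsRigid Ω g f) ∧
    -- the examples: catenoid × ℝ and helicoid × ℝ, the latter written as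
    -- `(s, t, x) ↦ (sinh s cos t, sinh s sin t, t, x)`
    IsRiemannianDomain catenoidDomain catenoidMetric ∧
    Set.BijOn toHelicoid catenoidDomain helicoidDomain ∧
    (∀ L ∈ ({catenoidLine, helicoidLine ∘ toHelicoid} : Set (Euc 3 → Euc 4)),
      Set.InjOn L catenoidDomain ∧
      IsIsometricImmersion catenoidDomain catenoidMetric L ∧
      IsMinimal catenoidDomain catenoidMetric L ∧
      IsIdeal catenoidDomain catenoidMetric L ∧
      HasDistinctPrincipalCurvatures catenoidDomain catenoidMetric L 3 ∧
      ¬ IsRigid catenoidDomain catenoidMetric L) ∧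
    ¬ AreCongruent catenoidDomain catenoidLine (helicoidLine ∘ toHelicoid) := by
  have hcat := hasGaussFrame_catenoidLine
  have hhel := hasGaussFrame_helicoidLine
  have hncong := not_areCongruent_catenoidLine_helicoidLine
  have hcat_rigid : ¬ IsRigid catenoidDomain catenoidMetric catenoidLine := fun h =>
    hncong (h _ (hhel.isIsometricImmersion _))
  have hhel_rigid : ¬ IsRigid catenoidDomain catenoidMetric (helicoidLine ∘ toHelicoid) :=
    fun h => hncong (h _ (hcat.isIsometricImmersion _)).symm
  refine ⟨⟨catenoidDomain, catenoidMetric, catenoidLine, isRiemannianDomain_catenoid,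
    hcat.isIsometricImmersion _, hcat.isMinimal _, hcat.isIdeal _,
    hcat.hasDistinctPrincipalCurvatures _, hcat_rigid⟩, isRiemannianDomain_catenoid,
    bijOn_toHelicoid, ?_, hncong⟩
  rintro L (rfl | rfl)
  · exact ⟨injOn_catenoidLine, hcat.isIsometricImmersion _, hcat.isMinimal _, hcat.isIdeal _,
      hcat.hasDistinctPrincipalCurvatures _, hcat_rigid⟩
  · exact ⟨injective_helicoidLine.comp_injOn bijOn_toHelicoid.injOn,
      hhel.isIsometricImmersion _, hhel.isMinimal _, hhel.isIdeal _,
      hhel.hasDistinctPrincipalCurvatures _, hhel_rigid⟩
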